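/- For $n\in\mathbb N$ put $$\delta^{(n)}_{\mathbb C}(\mathbf z)=\frac{1}{(2\pi i)^n}\,\frac{1}{z_1z_2\cdots z_n},\qquad \mathbf z=(z_1,\dots,z_n)\in\mathbb C^n .$$ For $r=(r_1,\dots,r_n)$ with all $r_k>0$ let $\Gamma_r=\{\mathbf w\in\mathbb C^n: w_k=r_ke^{i\theta_k},\ 0\le\theta_k\le 2\pi\}$ be the torus, oriented by $d\theta_1\wedge\cdots\wedge d\theta_n$, and $\overline D_r=\{\mathbf w\in\mathbb C^n: |w_k|\le r_k \text{ for all } k\}$ the closed polydisc. For a nonsingular complex $n\times n$ matrix $A$ let $A^{-1}\Gamma_r$ be the torus $\{\mathbf z : A\mathbf z\in\Gamma_r\}$, parametrized (and oriented) by $\theta\mapsto A^{-1}(r_1e^{i\theta_1},\dots,r_ne^{i\theta_n})$. **Theorem.** Let $A$ be a nonsingular complex $n\times n$ matrix. Then $$\delta^{(n)}_{\mathbb C}(A\mathbf z)=\frac{1}{\det A}\,\delta^{(n)}_{\mathbb C}(\mathbf z)$$ as functionals on holomorphic functions, each side being integrated over a torus around its own singular hyperplanes: for all $r,s\in(0,\infty)^n$,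 every open set $U\subseteq\mathbb C^n$ with $A^{-1}\overline D_r\subseteq U$ and $\overline D_s\subseteq U$, and every holomorphic $f:U\to\mathbb C$, $$\int_{A^{-1}\Gamma_r}\delta^{(n)}_{\mathbb C}(A\mathbf z)\,f(\mathbf z)\,dz_1\wedge\cdots\wedge dz_n=\frac{1}{\det A}\int_{\Gamma_s}\delta^{(n)}_{\mathbb C}(\mathbf z)\,f(\mathbf z)\,dz_1\wedge\cdots\wedge dz_n .$$ -/

import Mathlib

/-- The delta function on `ℂⁿ`: `δ(z₁, …, zₙ) = 1 / ((2 π i)ⁿ z₁ ⋯ zₙ)`. -/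
noncomputable def complexDelta (n : ℕ) (z : Fin n → ℂ) : ℂ :=
  1 / (2 * Real.pi * Complex.I) ^ n * (1 / ∏ i, z i)

/-- The closed polydisc `{w ∈ ℂⁿ : |wᵢ| ≤ rᵢ for all i}`. -/
def closedPolydisc {n : ℕ} (r : Fin n → ℝ) : Set (Fin n → ℂ) :=
  {w | ∀ i, ‖w i‖ ≤ r i}

/-- The contour integral `∫_γ g(z) dz₁ ∧ ⋯ ∧ dzₙ` over a parametrized contour
`γ : [0, 2π]ⁿ → ℂⁿ`: the pullback of `dz₁ ∧ ⋯ ∧ dzₙ` along `γ` is the determinant of the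
matrix of partial derivatives `∂γᵢ/∂θⱼ` times `dθ₁ ∧ ⋯ ∧ dθₙ`. -/
noncomputable def contourIntegral {n : ℕ} (γ : (Fin n → ℝ) → (Fin n → ℂ))
    (g : (Fin n → ℂ) → ℂ) : ℂ :=
  ∫ θ in Set.Icc (0 : Fin n → ℝ) (fun _ => 2 * Real.pi),
    (Matrix.of fun i j => deriv (fun t : ℝ => γ (Function.update θ j t) i) (θ j)).det * g (γ θ)

/-- The parametrized torus `{z : |(A z)ᵢ| = rᵢ for all i}`, for a nonsingular matrix `A`. It is
the preimage under `z ↦ A z` of the torus `wₖ = rₖ exp(i θₖ)`, with the orientation of the latter. -/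
noncomputable def preimageTorus {n : ℕ} (A : Matrix (Fin n) (Fin n) ℂ) (r : Fin n → ℝ) :
    (Fin n → ℝ) → (Fin n → ℂ) :=
  fun θ => A⁻¹.mulVec (torusMap 0 r θ)

/-- On the standard torus the contour integral is Mathlib's torus integral. -/
theorem contourIntegral_torusMap {n : ℕ} (r : Fin n → ℝ) (g : (Fin n → ℂ) → ℂ) :
    contourIntegral (torusMap 0 r) g = torusIntegral g 0 r := by
  unfold contourIntegral torusIntegral
  congr 1
  funext θ
  have h : (Matrix.of fun i j =>
      deriv (fun t : ℝ => torusMap 0 r (Function.update θ j t) i) (θ j)) =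
      Matrix.diagonal fun i => (r i * Complex.exp (θ i * Complex.I) * Complex.I : ℂ) := by
    ext i j
    by_cases hij : i = j
    · subst hij
      have h1 : HasDerivAt (fun t : ℝ => (t : ℂ) * Complex.I) (1 * Complex.I) (θ i) :=
        (Complex.ofRealCLM.hasDerivAt (x := θ i)).mul_const _
      have h2 := (h1.cexp.const_mul (r i : ℂ)).deriv
      simpa [torusMap, mul_assoc] using h2
    · simp [torusMap, Matrix.diagonal_apply_ne _ hij, Function.update_of_ne hij]
  rw [h, Matrix.det_diagonal, smul_eq_mul]

/-! Both sides equal `f 0 / A.det`, so neither torus has to be deformed into the other. Substituting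
w = Az on the left gives the Jacobian `A⁻¹.det` and the integral of δ(w) f(A⁻¹w) over the standard
torus (`contourIntegral_preimageTorus`). Cauchy's formula at the centre
(`torusIntegral_complexDelta_mul`), by induction on `n`, evaluates this and the right side, since
A⁻¹0 = 0. -/

theorem complexDelta_cons {n : ℕ} (x : ℂ) (y : Fin n → ℂ) :
    complexDelta (n + 1) (Fin.cons x y) =
      (2 * Real.pi * Complex.I)⁻¹ * x⁻¹ * complexDelta n y := by
  simp only [complexDelta, Fin.prod_univ_succ, Fin.cons_zero, Fin.cons_succ, pow_succ, one_div,
    mul_inv]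
  ring

theorem continuous_torusMap {n : ℕ} (c : Fin n → ℂ) (r : Fin n → ℝ) :
    Continuous (torusMap c r) := by
  unfold torusMap
  fun_prop

theorem torusMap_mem_closedPolydisc {n : ℕ} {r : Fin n → ℝ} (hr : ∀ i, 0 < r i)
    (θ : Fin n → ℝ) : torusMap 0 r θ ∈ closedPolydisc r := by
  intro i
  simp [torusMap, Complex.norm_exp_ofReal_mul_I, abs_of_pos (hr i)]

theorem torusMap_zero_apply_ne_zero {n : ℕ} {r : Fin n → ℝ} (hr : ∀ i, 0 < r i)
    (θ : Fin n → ℝ) (i : Fin n) : torusMap 0 r θ i ≠ 0 := by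
  simp [torusMap, (hr i).ne', Complex.exp_ne_zero]

/-- The delta function times a function continuous on the closed polydisc is integrable over the
distinguished boundary. -/
theorem torusIntegrable_complexDelta_mul {n : ℕ} {r : Fin n → ℝ} (hr : ∀ i, 0 < r i)
    {g : (Fin n → ℂ) → ℂ} (hg : ContinuousOn g (closedPolydisc r)) :
    TorusIntegrable (fun z => complexDelta n z * g z) 0 r := by
  have h1 : Continuous fun θ => g (torusMap 0 r θ) :=
    hg.comp_continuous (continuous_torusMap 0 r) (torusMap_mem_closedPolydisc hr)
  have h2 : Continuous fun θ => complexDelta n (torusMap 0 r θ) := by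
    have h3 : Continuous fun θ => ∏ i, torusMap 0 r θ i :=
      continuous_finsetProd _ fun i _ => (continuous_apply i).comp (continuous_torusMap 0 r)
    exact continuous_const.mul (continuous_const.div h3 fun θ =>
      Finset.prod_ne_zero_iff.2 fun i _ => torusMap_zero_apply_ne_zero hr θ i)
  exact (h2.mul h1).continuousOn.integrableOn_compact isCompact_Icc

theorem cons_mem_closedPolydisc {n : ℕ} {r : Fin (n + 1) → ℝ} {x : ℂ} {y : Fin n → ℂ}
    (hx : ‖x‖ ≤ r 0) (hy : y ∈ closedPolydisc (r ∘ Fin.succ)) :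
    Fin.cons x y ∈ closedPolydisc r :=
  Fin.cases hx hy

/-- The Cauchy integral formula at the centre of a polydisc. -/
theorem torusIntegral_complexDelta_mul {n : ℕ} {r : Fin n → ℝ} (hr : ∀ i, 0 < r i)
    {U : Set (Fin n → ℂ)} (hU : IsOpen U) (hrU : closedPolydisc r ⊆ U)
    {g : (Fin n → ℂ) → ℂ} (hg : DifferentiableOn ℂ g U) :
    torusIntegral (fun z => complexDelta n z * g z) 0 r = g 0 := by
  induction n with
  | zero => simp [complexDelta]
  | succ n ih =>
    rw [torusIntegral_succ (torusIntegrable_complexDelta_mul hr (hg.continuousOn.mono hrU))]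
    have hcons : Differentiable ℂ fun p : ℂ × (Fin n → ℂ) =>
        (Fin.cons p.1 p.2 : Fin (n + 1) → ℂ) :=
      differentiable_pi.2 <| Fin.cases (by simp) fun i => by
        simpa using differentiable_pi.1 differentiable_snd i
    -- The slice of `U` at `x` is open and contains the smaller polydisc because ‖x‖ = `r 0`, so the
    -- induction hypothesis applies. The form `x - 0` matches the one-variable Cauchy formula used
    -- below.
    have hinner : ∀ x ∈ Metric.sphere (0 : ℂ) (r 0),
        torusIntegral (fun y => complexDelta (n + 1) (Fin.cons x y) * g (Fin.cons x y))
          0 (r ∘ Fin.succ) = (2 * Real.pi * Complex.I)⁻¹ * ((x - 0)⁻¹ * g (Fin.cons x 0)) := by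
      intro x hx
      have hsec : Differentiable ℂ fun y : Fin n → ℂ => (Fin.cons x y : Fin (n + 1) → ℂ) :=
        hcons.comp ((differentiable_const x).prodMk differentiable_id)
      simp only [complexDelta_cons, mul_assoc, torusIntegral_const_mul, sub_zero]
      congr 2
      refine ih (fun i => hr i.succ) (hU.preimage hsec.continuous)
        (fun y hy => hrU (cons_mem_closedPolydisc ?_ hy))
        (g := fun y => g (Fin.cons x y)) (hg.comp hsec.differentiableOn fun y hy => hy)
      simpa using (mem_sphere_zero_iff_norm.1 hx).le
    have hcirc : DifferentiableOn ℂ (fun x : ℂ => g (Fin.cons x 0))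
        (Metric.closedBall 0 (r 0)) := by
      refine hg.comp (hcons.comp (differentiable_id.prodMk
        (differentiable_const (0 : Fin n → ℂ)))).differentiableOn fun x hx => hrU ?_
      exact cons_mem_closedPolydisc (by simpa using hx) fun i => by simpa using (hr i.succ).le
    have h0 : (Fin.cons 0 0 : Fin (n + 1) → ℂ) = 0 := by
      ext i
      refine Fin.cases ?_ (fun j => ?_) i <;> simp
    have hpi : (2 * Real.pi * Complex.I : ℂ) ≠ 0 := Complex.two_pi_I_ne_zero
    calc _ = circleIntegral (fun x => (2 * Real.pi * Complex.I)⁻¹ *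
          ((x - 0)⁻¹ * g (Fin.cons x 0))) 0 (r 0) :=
          circleIntegral.integral_congr (hr 0).le hinner
      _ = g 0 := by
          rw [circleIntegral.integral_const_mul]
          have := hcirc.circleIntegral_sub_inv_smul (Metric.mem_ball_self (hr 0))
          simp only [smul_eq_mul, h0] at this
          rw [this, inv_mul_cancel_left₀ hpi]

/-- Differentiating A⁻¹ applied to the torus term by term needs actual differentiability of each
coordinate, not just a value of `deriv`. -/
theorem hasDerivAt_torusMap_update {n : ℕ} (c : Fin n → ℂ) (r θ : Fin n → ℝ) (j k : Fin n) :
    HasDerivAt (fun t : ℝ => torusMap c r (Function.update θ j t) k)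
      (Matrix.diagonal (fun i => (r i * Complex.exp (θ i * Complex.I) * Complex.I : ℂ)) k j)
      (θ j) := by
  by_cases hkj : k = j
  · subst hkj
    have h1 : HasDerivAt (fun t : ℝ => (t : ℂ) * Complex.I) (1 * Complex.I) (θ k) :=
      (Complex.ofRealCLM.hasDerivAt (x := θ k)).mul_const _
    simpa [torusMap, mul_assoc] using (h1.cexp.const_mul (r k : ℂ)).const_add (c k)
  · simpa [torusMap, Matrix.diagonal_apply_ne _ hkj, Function.update_of_ne hkj] using
      hasDerivAt_const (θ j) _

/-- The linear change of variables for integrals over the preimage of a torus. -/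
theorem contourIntegral_preimageTorus {n : ℕ} (A : Matrix (Fin n) (Fin n) ℂ) (r : Fin n → ℝ)
    (g : (Fin n → ℂ) → ℂ) :
    contourIntegral (preimageTorus A r) g =
      A⁻¹.det * torusIntegral (fun w => g (A⁻¹.mulVec w)) 0 r := by
  rw [← torusIntegral_const_mul]
  unfold contourIntegral torusIntegral
  congr 1
  funext θ
  have h : (Matrix.of fun i j =>
      deriv (fun t : ℝ => preimageTorus A r (Function.update θ j t) i) (θ j)) =
      A⁻¹ * Matrix.diagonal fun i => (r i * Complex.exp (θ i * Complex.I) * Complex.I : ℂ) := by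
    ext i j
    rw [Matrix.of_apply, Matrix.mul_apply]
    exact (HasDerivAt.fun_sum (u := Finset.univ) fun k _ =>
      (hasDerivAt_torusMap_update 0 r θ j k).const_mul (A⁻¹ i k)).deriv
  rw [h, Matrix.det_mul, Matrix.det_diagonal, smul_eq_mul, preimageTorus]
  ring

theorem mainTheorem5 (n : ℕ) (A : Matrix (Fin n) (Fin n) ℂ) (hA : A.det ≠ 0)
    (r s : Fin n → ℝ) (hr : ∀ i, 0 < r i) (hs : ∀ i, 0 < s i)
    (U : Set (Fin n → ℂ)) (hU : IsOpen U)
    (hrU : {z | A.mulVec z ∈ closedPolydisc r} ⊆ U) (hsU : closedPolydisc s ⊆ U)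
    (f : (Fin n → ℂ) → ℂ) (hf : DifferentiableOn ℂ f U) :
    contourIntegral (preimageTorus A r) (fun z => complexDelta n (A.mulVec z) * f z) =
      1 / A.det * torusIntegral (fun z => complexDelta n z * f z) 0 s := by
  have hinv (w : Fin n → ℂ) : A.mulVec (A⁻¹.mulVec w) = w := by
    rw [Matrix.mulVec_mulVec, Matrix.mul_nonsing_inv _ hA.isUnit, Matrix.one_mulVec]
  have hlin : Differentiable ℂ fun w : Fin n → ℂ => A⁻¹.mulVec w :=
    (LinearMap.toContinuousLinearMap (Matrix.mulVecLin A⁻¹)).differentiable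
  rw [contourIntegral_preimageTorus, torusIntegral_complexDelta_mul hs hU hsU hf]
  simp only [hinv]
  -- Cauchy's formula for f ∘ A⁻¹ on the preimage of `U` under A⁻¹, an open set containing the
  -- polydisc of radii `r`.
  rw [torusIntegral_complexDelta_mul hr (hU.preimage hlin.continuous)
    (fun w hw => hrU (by simpa [hinv] using hw)) (g := fun w => f (A⁻¹.mulVec w))
    (hf.comp hlin.differentiableOn fun w hw => hw), Matrix.mulVec_zero,
    Matrix.det_nonsing_inv, Ring.inverse_eq_inv', one_div]
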